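/- For complex numbers (in particular, real numbers) $a,b,c$ with $c \notin \{0,-1,-2,\dots\}$ and for $|z|<1$, let $$F(a,b;c;z) = {}_2F_1(a,b;c;z) = \sum_{n=0}^{\infty} \frac{(a)_n (b)_n}{(c)_n}\,\frac{z^n}{n!}, \qquad (a)_n = a(a+1)\cdots(a+n-1),\quad (a)_0 = 1,$$ denote the Gauss hypergeometric function. If $x$ is a real number with $0 < x < 1$, then $$\sqrt{1+3x}\; F\Big(\frac14,\frac34;1;x^2\Big) = F\Big(\frac14,\frac34;1;\,1-\Big(\frac{1-x}{1+3x}\Big)^2\Big).$$ -/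

import Mathlib

/-!
With `F = ₂F₁(1/4, 3/4; 1; ·)`, the hypergeometric equation has the self-adjoint form
`(t (1 - t) F')' = 3/16 F`. Pulling it back along `φ x = 1 - ((1 - x) / (1 + 3 x))²`, and along
`x ↦ x²` followed by multiplication of the solution by `√(1 + 3 x)`, gives the same equation
`(p y')' = q y` with `p x = x (1 - x²) / (1 + 3 x)` and `q x = 3/2 (1 - x) / (1 + 3 x)³`.
Since `p 0 = 0`, the conserved Wronskian `p (u v' - u' v)` of two solutions regular at `0` vanishes,
so `v / u` is constant. Both sides of the formula are regular at `0` and equal `1` there.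
-/

open Set FormalMultilinearSeries

/-! ### Power series given by their coefficients -/

theorem hasFPowerSeriesOnBall_deriv_ofScalars {𝕜 : Type*} [NontriviallyNormedField 𝕜]
    [CompleteSpace 𝕜] {f : 𝕜 → 𝕜} {c : ℕ → 𝕜} {x : 𝕜} {r : ENNReal}
    (h : HasFPowerSeriesOnBall f (ofScalars 𝕜 c) x r) :
    HasFPowerSeriesOnBall (deriv f) (ofScalars 𝕜 fun n ↦ (n + 1) * c (n + 1)) x r := by
  convert! (ContinuousLinearMap.apply 𝕜 𝕜 (1 : 𝕜)).comp_hasFPowerSeriesOnBall h.fderiv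
  ext n
  simp

theorem hasSum_of_hasFPowerSeriesOnBall_ofScalars {𝕜 : Type*} [NontriviallyNormedField 𝕜]
    {f : 𝕜 → 𝕜} {c : ℕ → 𝕜} {r : ENNReal} {t : 𝕜}
    (h : HasFPowerSeriesOnBall f (ofScalars 𝕜 c) 0 r) (ht : t ∈ Metric.eball 0 r) :
    HasSum (fun n ↦ c n * t ^ n) (f t) := by
  simpa only [ofScalars_apply_eq, smul_eq_mul, zero_add] using h.hasSum ht

theorem hasSum_mul_pow_of_succ {R : Type*} [CommRing R] [TopologicalSpace R] [IsTopologicalRing R]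
    {d e : ℕ → R} {t s : R} (h : HasSum (fun n ↦ d n * t ^ n) s) (he₀ : e 0 = 0)
    (he : ∀ n, e (n + 1) = d n) : HasSum (fun n ↦ e n * t ^ n) (t * s) := by
  rw [← hasSum_nat_add_iff' 1]
  convert! h.mul_left t using 1
  · ext n
    rw [he]
    ring
  · simp [he₀]

/-! ### The hypergeometric equation -/

theorem mem_eball_zero_one_of_norm_lt_one {E : Type*} [SeminormedAddCommGroup E] {t : E}
    (ht : ‖t‖ < 1) : t ∈ Metric.eball (0 : E) 1 := by
  simpa [enorm_eq_nnnorm, ← NNReal.coe_lt_coe] using ht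

theorem ordinaryHypergeometricCoefficient_succ {K : Type*} [Field K] [CharZero K] {a b c : K}
    (hc : ∀ k : ℕ, (k : K) ≠ -c) (n : ℕ) :
    (n + 1) * (c + n) * ordinaryHypergeometricCoefficient a b c (n + 1) =
      (a + n) * (b + n) * ordinaryHypergeometricCoefficient a b c n := by
  have add_ne_zero : c + n ≠ 0 := fun h ↦ hc n (by linear_combination h)
  have pochhammer_ne_zero : (ascPochhammer K n).eval c ≠ 0 := by
    rw [Ne, ascPochhammer_eval_eq_zero_iff]
    rintro ⟨k, -, hk⟩
    exact hc k hk
  have factorial_ne_zero : (n.factorial : K) ≠ 0 := mod_cast n.factorial_ne_zero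
  have succ_ne_zero : (n + 1 : K) ≠ 0 := n.cast_add_one_ne_zero
  simp only [ordinaryHypergeometricCoefficient, ascPochhammer_succ_eval, Nat.factorial_succ,
    Nat.cast_mul, Nat.cast_succ]
  field_simp

section Hypergeometric

variable {𝕜 : Type*} [RCLike 𝕜] {a b c t : 𝕜}

theorem one_le_ordinaryHypergeometricSeries_radius (a b c : 𝕜) :
    1 ≤ (ordinaryHypergeometricSeries 𝕜 a b c).radius := by
  by_cases habc : ∀ k : ℕ, (k : 𝕜) ≠ -a ∧ (k : 𝕜) ≠ -b ∧ (k : 𝕜) ≠ -c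
  · exact (ordinaryHypergeometricSeries_radius_eq_one 𝕜 a b c habc).ge
  · push Not at habc
    obtain ⟨k, hk⟩ := habc
    have terminates : (ordinaryHypergeometricSeries 𝕜 a b c).radius = ⊤ :=
      radius_eq_top_of_forall_image_add_eq_zero _ (k + 1) fun n ↦
        ordinaryHypergeometricSeries_eq_zero_of_neg_nat a b c (k := k) (by tauto) (by lia)
    simp only [terminates, le_top]

theorem hasFPowerSeriesOnBall_ordinaryHypergeometric (a b c : 𝕜) :
    HasFPowerSeriesOnBall (₂F₁ a b c : 𝕜 → 𝕜)
      (ofScalars 𝕜 (ordinaryHypergeometricCoefficient a b c)) 0 1 :=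
  have one_le_radius := one_le_ordinaryHypergeometricSeries_radius a b c
  ((ordinaryHypergeometricSeries 𝕜 a b c).hasFPowerSeriesOnBall
    (one_pos.trans_le one_le_radius)).mono one_pos one_le_radius

theorem hasDerivAt_ordinaryHypergeometric (a b c : 𝕜) (ht : ‖t‖ < 1) :
    HasDerivAt (₂F₁ a b c : 𝕜 → 𝕜) (deriv (₂F₁ a b c) t) t :=
  ((hasFPowerSeriesOnBall_ordinaryHypergeometric a b c).analyticAt_of_mem
    (mem_eball_zero_one_of_norm_lt_one ht)).differentiableAt.hasDerivAt

theorem hasDerivAt_deriv_ordinaryHypergeometric (a b c : 𝕜) (ht : ‖t‖ < 1) :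
    HasDerivAt (deriv (₂F₁ a b c : 𝕜 → 𝕜)) (deriv (deriv (₂F₁ a b c)) t) t :=
  ((hasFPowerSeriesOnBall_ordinaryHypergeometric a b c).analyticAt_of_mem
    (mem_eball_zero_one_of_norm_lt_one ht)).deriv.differentiableAt.hasDerivAt

theorem ordinaryHypergeometric_differential_equation (hc : ∀ k : ℕ, (k : 𝕜) ≠ -c)
    (ht : ‖t‖ < 1) :
    t * (1 - t) * deriv (deriv (₂F₁ a b c)) t + (c - (a + b + 1) * t) * deriv (₂F₁ a b c) t =
      a * b * ₂F₁ a b c t := by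
  have series := hasFPowerSeriesOnBall_ordinaryHypergeometric a b c
  have deriv_series := hasFPowerSeriesOnBall_deriv_ofScalars series
  have ht' := mem_eball_zero_one_of_norm_lt_one ht
  have sum_F := hasSum_of_hasFPowerSeriesOnBall_ofScalars series ht'
  have sum_F' := hasSum_of_hasFPowerSeriesOnBall_ofScalars deriv_series ht'
  have sum_F'' := hasSum_of_hasFPowerSeriesOnBall_ofScalars
    (hasFPowerSeriesOnBall_deriv_ofScalars deriv_series) ht'
  set A := ordinaryHypergeometricCoefficient a b c
  have sum_t_F' : HasSum (fun n : ℕ ↦ n * A n * t ^ n) (t * deriv (₂F₁ a b c) t) :=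
    hasSum_mul_pow_of_succ sum_F' (by simp) (by simp)
  have sum_t_F'' : HasSum (fun n : ℕ ↦ n * ((n + 1) * A (n + 1)) * t ^ n)
      (t * deriv (deriv (₂F₁ a b c)) t) :=
    hasSum_mul_pow_of_succ sum_F'' (by simp) (by simp)
  have sum_tt_F'' : HasSum (fun n : ℕ ↦ n * (n - 1) * A n * t ^ n)
      (t * (t * deriv (deriv (₂F₁ a b c)) t)) :=
    hasSum_mul_pow_of_succ sum_t_F'' (by simp) fun n ↦ by push_cast; ring
  have lhs := sum_t_F''.add (sum_F'.mul_left c)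
  have rhs := (sum_tt_F''.add (sum_t_F'.mul_left (a + b + 1))).add (sum_F.mul_left (a * b))
  have lhs_eq_rhs := lhs.unique <| rhs.congr_fun fun n ↦ by
    linear_combination t ^ n * ordinaryHypergeometricCoefficient_succ (a := a) (b := b) hc n
  linear_combination lhs_eq_rhs

end Hypergeometric

theorem ordinaryHypergeometric_pos {a b c t : ℝ} (ha : 0 < a) (hb : 0 < b) (hc : 0 < c)
    (ht : t ∈ Ico 0 1) : 0 < ₂F₁ a b c t := by
  have sum_F := hasSum_of_hasFPowerSeriesOnBall_ofScalars
    (hasFPowerSeriesOnBall_ordinaryHypergeometric a b c)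
    (mem_eball_zero_one_of_norm_lt_one (t := t) (by simpa [abs_of_nonneg ht.1] using ht.2))
  rw [← sum_F.tsum_eq]
  refine sum_F.summable.tsum_pos (fun n ↦ ?_) 0 (by simp)
  have := ht.1
  have := ascPochhammer_pos n a ha
  have := ascPochhammer_pos n b hb
  have := ascPochhammer_pos n c hc
  positivity

/-! ### Sturm–Liouville equations with a singular endpoint -/

theorem eqOn_const_of_hasDerivAt_zero {f : ℝ → ℝ} {a b : ℝ} (hf : ContinuousOn f (Ico a b))
    (hf' : ∀ x ∈ Ioo a b, HasDerivAt f 0 x) : EqOn f (fun _ ↦ f a) (Ico a b) := by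
  rintro x ⟨hax, hxb⟩
  rcases hax.eq_or_lt with rfl | hax
  · rfl
  obtain ⟨z, -, slope_eq⟩ := exists_hasDerivAt_eq_slope f (fun _ ↦ 0) hax
    (hf.mono (Icc_subset_Ico_right hxb)) fun z hz ↦ hf' z ⟨hz.1, hz.2.trans hxb⟩
  have : f x - f a = 0 := (div_eq_zero_iff.1 slope_eq.symm).resolve_right (sub_pos.2 hax).ne'
  exact sub_eq_zero.1 this

/-- `u` solves the Sturm–Liouville equation `(p u')' = q u` on `(a, b)` and is regular at `a`, where
`p` is allowed to vanish. The equation is encoded as the first-order system `u' = U / p`, `U' = q u`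
for `u` and its flux `U = p u'`; regularity means that `u` and `U` are continuous at `a` and
`U a = 0`. -/
structure IsRegularSolution (p q u U : ℝ → ℝ) (a b : ℝ) : Prop where
  continuousOn : ContinuousOn u (Ico a b)
  continuousOn_flux : ContinuousOn U (Ico a b)
  flux_left : U a = 0
  hasDerivAt : ∀ x ∈ Ioo a b, HasDerivAt u (U x / p x) x
  hasDerivAt_flux : ∀ x ∈ Ioo a b, HasDerivAt U (q x * u x) x

namespace IsRegularSolution

variable {p q u U v V : ℝ → ℝ} {a b : ℝ}

theorem congr {p₁ q₁ : ℝ → ℝ} (h : IsRegularSolution p q u U a b) (hp : EqOn p p₁ (Ioo a b))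
    (hq : EqOn q q₁ (Ioo a b)) : IsRegularSolution p₁ q₁ u U a b where
  __ := h
  hasDerivAt x hx := hp hx ▸ h.hasDerivAt x hx
  hasDerivAt_flux x hx := hq hx ▸ h.hasDerivAt_flux x hx

theorem const_mul {k : ℝ} (h : IsRegularSolution p q u U a b) (hk : k ≠ 0) :
    IsRegularSolution (fun x ↦ k * p x) (fun x ↦ k * q x) u (fun x ↦ k * U x) a b where
  continuousOn := h.continuousOn
  continuousOn_flux := h.continuousOn_flux.const_mul k
  flux_left := by simp [h.flux_left]
  hasDerivAt x hx := by simpa only [mul_div_mul_left _ _ hk] using h.hasDerivAt x hx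
  hasDerivAt_flux x hx := by
    simpa only [mul_assoc] using (h.hasDerivAt_flux x hx).const_mul k

theorem comp {φ φ' : ℝ → ℝ} {α β : ℝ} (h : IsRegularSolution p q u U a b)
    (hφ : ∀ x ∈ Ico α β, HasDerivAt φ (φ' x) x) (hα : φ α = a)
    (maps_Ioo : MapsTo φ (Ioo α β) (Ioo a b)) :
    IsRegularSolution (fun x ↦ p (φ x) / φ' x) (fun x ↦ q (φ x) * φ' x) (fun x ↦ u (φ x))
      (fun x ↦ U (φ x)) α β := by
  have maps_Ico : MapsTo φ (Ico α β) (Ico a b) := by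
    rintro x ⟨hαx, hxβ⟩
    rcases hαx.eq_or_lt with rfl | hαx
    · obtain ⟨y, hy⟩ := nonempty_Ioo.2 hxβ
      exact ⟨hα.ge, hα.trans_lt ((maps_Ioo hy).1.trans (maps_Ioo hy).2)⟩
    · exact Ioo_subset_Ico_self (maps_Ioo ⟨hαx, hxβ⟩)
  have hφ_cont : ContinuousOn φ (Ico α β) := fun x hx ↦ (hφ x hx).continuousAt.continuousWithinAt
  refine ⟨h.continuousOn.comp hφ_cont maps_Ico, h.continuousOn_flux.comp hφ_cont maps_Ico,
    by simp [hα, h.flux_left], fun x hx ↦ ?_, fun x hx ↦ ?_⟩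
  · convert! (h.hasDerivAt _ (maps_Ioo hx)).comp x (hφ x (Ioo_subset_Ico_self hx)) using 1
    rw [div_div_eq_mul_div, div_mul_eq_mul_div]
  · convert! (h.hasDerivAt_flux _ (maps_Ioo hx)).comp x (hφ x (Ioo_subset_Ico_self hx)) using 1
    ring

/-- Conjugating by `g` rests on `(p (g u)')' - q g u = g⁻¹ ((p g² u')' - g (q g - (p g')') u)`. -/
theorem mul_left {q₀ g g' : ℝ → ℝ} (h : IsRegularSolution (fun x ↦ p x * g x ^ 2) q₀ u U a b)
    (hp : ∀ x ∈ Ioo a b, p x ≠ 0) (hpa : p a = 0) (hg₀ : ∀ x ∈ Ico a b, g x ≠ 0)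
    (hg : ∀ x ∈ Ico a b, HasDerivAt g (g' x) x)
    (hpg_cont : ContinuousOn (fun x ↦ p x * g' x) (Ico a b))
    (hpg : ∀ x ∈ Ioo a b, HasDerivAt (fun x ↦ p x * g' x) (q x * g x - q₀ x / g x) x) :
    IsRegularSolution p q (fun x ↦ g x * u x) (fun x ↦ p x * g' x * u x + U x / g x) a b := by
  have hg_cont : ContinuousOn g (Ico a b) := fun x hx ↦ (hg x hx).continuousAt.continuousWithinAt
  refine ⟨hg_cont.mul h.continuousOn,
    (hpg_cont.mul h.continuousOn).add (h.continuousOn_flux.div hg_cont hg₀),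
    by simp [hpa, h.flux_left], fun x hx ↦ ?_, fun x hx ↦ ?_⟩
  all_goals
    have hx' := Ioo_subset_Ico_self hx
    have hpx := hp x hx
    have hgx := hg₀ x hx'
  · convert! (hg x hx').mul (h.hasDerivAt x hx) using 1
    field
  · convert! ((hpg x hx).mul (h.hasDerivAt x hx)).add
      ((h.hasDerivAt_flux x hx).div (hg x hx') hgx) using 1
    field

theorem wronskian_eq_zero (hu : IsRegularSolution p q u U a b)
    (hv : IsRegularSolution p q v V a b) {x : ℝ} (hx : x ∈ Ico a b) :
    u x * V x - U x * v x = 0 := by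
  have constant := eqOn_const_of_hasDerivAt_zero (f := fun x ↦ u x * V x - U x * v x)
    ((hu.continuousOn.mul hv.continuousOn_flux).sub (hu.continuousOn_flux.mul hv.continuousOn))
    fun y hy ↦ by
      convert! ((hu.hasDerivAt y hy).mul (hv.hasDerivAt_flux y hy)).sub
        ((hu.hasDerivAt_flux y hy).mul (hv.hasDerivAt y hy)) using 1
      ring
  simpa [hu.flux_left, hv.flux_left] using constant hx

theorem eqOn_of_eq_left (hu : IsRegularSolution p q u U a b)
    (hv : IsRegularSolution p q v V a b) (hu₀ : ∀ x ∈ Ico a b, u x ≠ 0) (huv : u a = v a) :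
    EqOn u v (Ico a b) := by
  intro x hx
  have quotient_eq : v x / u x = v a / u a :=
    eqOn_const_of_hasDerivAt_zero (f := fun x ↦ v x / u x)
      (hv.continuousOn.div hu.continuousOn hu₀) (fun y hy ↦ by
        have hy' := Ioo_subset_Ico_self hy
        convert! (hv.hasDerivAt y hy).div (hu.hasDerivAt y hy) (hu₀ y hy') using 1
        linear_combination -(hu.wronskian_eq_zero hv hy') / (p y * u y ^ 2)) hx
  have ha : a ∈ Ico a b := left_mem_Ico.2 (hx.1.trans_lt hx.2)
  rw [← huv, div_self (hu₀ a ha), div_eq_one_iff_eq (hu₀ x hx)] at quotient_eq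
  exact quotient_eq.symm

end IsRegularSolution

theorem isRegularSolution_ordinaryHypergeometric (a : ℝ) :
    IsRegularSolution (fun t ↦ t * (1 - t)) (fun _ ↦ a * (1 - a)) (₂F₁ a (1 - a) 1)
      (fun t ↦ t * (1 - t) * deriv (₂F₁ a (1 - a) (1 : ℝ)) t) 0 1 := by
  have norm_lt {t : ℝ} (ht : t ∈ Ico 0 1) : ‖t‖ < 1 := by simpa [abs_of_nonneg ht.1] using ht.2
  have hF {t : ℝ} (ht : t ∈ Ico 0 1) := hasDerivAt_ordinaryHypergeometric a (1 - a) 1 (norm_lt ht)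
  have flux_deriv : ∀ t ∈ Ico (0 : ℝ) 1,
      HasDerivAt (fun t ↦ t * (1 - t) * deriv (₂F₁ a (1 - a) (1 : ℝ)) t)
        (a * (1 - a) * ₂F₁ a (1 - a) 1 t) t := by
    intro t ht
    have one_ne : ∀ k : ℕ, (k : ℝ) ≠ -1 := fun k ↦
      (neg_one_lt_zero.trans_le k.cast_nonneg).ne'
    have ode := ordinaryHypergeometric_differential_equation (a := a) (b := 1 - a) one_ne
      (norm_lt ht)
    convert! ((hasDerivAt_id t).mul ((hasDerivAt_id t).const_sub 1)).mul
      (hasDerivAt_deriv_ordinaryHypergeometric a (1 - a) 1 (norm_lt ht)) using 1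
    simp only [id_eq, Pi.mul_apply]
    linear_combination -ode
  refine ⟨fun t ht ↦ (hF ht).continuousAt.continuousWithinAt,
    fun t ht ↦ (flux_deriv t ht).continuousAt.continuousWithinAt, by simp, fun t ht ↦ ?_,
    fun t ht ↦ flux_deriv t (Ioo_subset_Ico_self ht)⟩
  have : t * (1 - t) ≠ 0 := (mul_pos ht.1 (sub_pos.2 ht.2)).ne'
  simpa only [mul_div_cancel_left₀ _ this] using hF (Ioo_subset_Ico_self ht)

/-! ### The two pullbacks -/

namespace QuadraticTransformation

/-- The argument `1 - ((1 - x) / (1 + 3 x))²` on the right-hand side of the transformation. -/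
noncomputable def complementaryArg (x : ℝ) : ℝ := 1 - ((1 - x) / (1 + 3 * x)) ^ 2

/-- The coefficient `p` of the Sturm–Liouville equation `(p y')' = q y` which both sides of the
transformation solve. -/
noncomputable def weight (x : ℝ) : ℝ := x * (1 - x ^ 2) / (1 + 3 * x)

/-- The coefficient `q` of the Sturm–Liouville equation `(p y')' = q y` which both sides of the
transformation solve. -/
noncomputable def potential (x : ℝ) : ℝ := 3 / 2 * (1 - x) / (1 + 3 * x) ^ 3

variable {x : ℝ}

theorem complementaryArg_zero : complementaryArg 0 = 0 := by simp [complementaryArg]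

theorem complementaryArg_mem_Ioo (hx : x ∈ Ioo 0 1) : complementaryArg x ∈ Ioo 0 1 := by
  obtain ⟨hx0, hx1⟩ := hx
  have ratio_pos : 0 < (1 - x) / (1 + 3 * x) := div_pos (by linarith) (by linarith)
  have ratio_lt_one : (1 - x) / (1 + 3 * x) < 1 := by
    rw [div_lt_one (by linarith)]
    linarith
  exact ⟨sub_pos.2 (pow_lt_one₀ ratio_pos.le ratio_lt_one two_ne_zero),
    sub_lt_self 1 (pow_pos ratio_pos 2)⟩

theorem hasDerivAt_complementaryArg (hx : 1 + 3 * x ≠ 0) :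
    HasDerivAt complementaryArg (8 * (1 - x) / (1 + 3 * x) ^ 3) x := by
  convert! (((((hasDerivAt_id x).const_sub 1).div
    (((hasDerivAt_id x).const_mul 3).const_add 1) hx).pow 2).const_sub 1) using 1
  simp only [id_eq, Pi.div_apply, Nat.add_one_sub_one, pow_one]
  push_cast
  field

theorem hasDerivAt_sqrt_one_add_three_mul (hx : 0 < 1 + 3 * x) :
    HasDerivAt (fun x ↦ √(1 + 3 * x)) (3 / (2 * √(1 + 3 * x))) x := by
  simpa using (((hasDerivAt_id x).const_mul 3).const_add 1).sqrt hx.ne'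

theorem isRegularSolution_one_quarter :
    ∃ U, IsRegularSolution (fun t ↦ t * (1 - t)) (fun _ ↦ 3 / 16)
      (₂F₁ (1 / 4 : ℝ) (3 / 4 : ℝ) (1 : ℝ)) U 0 1 := by
  have h := isRegularSolution_ordinaryHypergeometric (1 / 4)
  norm_num at h ⊢
  exact ⟨_, h⟩

theorem isRegularSolution_comp_complementaryArg :
    ∃ V, IsRegularSolution weight potential
      (fun x ↦ ₂F₁ (1 / 4 : ℝ) (3 / 4 : ℝ) (1 : ℝ) (complementaryArg x)) V 0 1 := by
  obtain ⟨U, hU⟩ := isRegularSolution_one_quarter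
  refine ⟨_, (hU.comp (fun x hx ↦ hasDerivAt_complementaryArg (by linarith [hx.1]))
    complementaryArg_zero fun x ↦ complementaryArg_mem_Ioo).congr (fun x hx ↦ ?_) fun x _ ↦ ?_⟩
  · have : 0 < x := hx.1
    have : 1 - x ≠ 0 := (sub_pos.2 hx.2).ne'
    simp only [complementaryArg, weight]
    field_simp
    ring
  · simp only [potential]
    ring

theorem isRegularSolution_comp_sq :
    ∃ U, IsRegularSolution (fun x ↦ x * (1 - x ^ 2)) (fun x ↦ 3 / 4 * x)
      (fun x ↦ ₂F₁ (1 / 4 : ℝ) (3 / 4 : ℝ) (1 : ℝ) (x ^ 2)) U 0 1 := by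
  obtain ⟨U, hU⟩ := isRegularSolution_one_quarter
  refine ⟨_, ((hU.comp (fun x _ ↦ hasDerivAt_pow 2 x) (zero_pow two_ne_zero) fun x hx ↦
    ⟨pow_pos hx.1 2, pow_lt_one₀ hx.1.le hx.2 two_ne_zero⟩).const_mul two_ne_zero).congr
    (fun x hx ↦ ?_) fun x _ ↦ ?_⟩
  · have : x ≠ 0 := hx.1.ne'
    push_cast
    field
  · push_cast
    ring

theorem hasDerivAt_weight_mul_deriv_sqrt (hx : 0 < 1 + 3 * x) :
    HasDerivAt (fun x ↦ weight x * (3 / (2 * √(1 + 3 * x))))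
      (potential x * √(1 + 3 * x) - 3 / 4 * x / √(1 + 3 * x)) x := by
  have sqrt_pos : 0 < √(1 + 3 * x) := Real.sqrt_pos.2 hx
  have hnum : HasDerivAt (fun x : ℝ ↦ x * (1 - x ^ 2)) (1 - 3 * x ^ 2) x := by
    convert! (hasDerivAt_id x).mul ((hasDerivAt_pow 2 x).const_sub 1) using 1
    simp only [id_eq]
    push_cast
    ring
  have hden : HasDerivAt (fun x : ℝ ↦ 1 + 3 * x) 3 x := by
    simpa using ((hasDerivAt_id x).const_mul 3).const_add 1
  convert! (hnum.div hden hx.ne').mul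
    ((hasDerivAt_const x 3).div ((hasDerivAt_sqrt_one_add_three_mul hx).const_mul 2)
      (by positivity)) using 1
  have sq_sqrt : √(1 + 3 * x) ^ 2 = 1 + 3 * x := Real.sq_sqrt hx.le
  simp only [potential, Pi.div_apply]
  generalize √(1 + 3 * x) = s at *
  obtain rfl : x = (s ^ 2 - 1) / 3 := by linarith
  field_simp
  ring

theorem isRegularSolution_sqrt_mul_comp_sq :
    ∃ U, IsRegularSolution weight potential
      (fun x ↦ √(1 + 3 * x) * ₂F₁ (1 / 4 : ℝ) (3 / 4 : ℝ) (1 : ℝ) (x ^ 2)) U 0 1 := by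
  obtain ⟨U, hU⟩ := isRegularSolution_comp_sq
  have one_add_pos {x : ℝ} (hx : x ∈ Ico 0 1) : 0 < 1 + 3 * x := by linarith [hx.1]
  have weight_mul_sq : EqOn (fun x ↦ x * (1 - x ^ 2)) (fun x ↦ weight x * √(1 + 3 * x) ^ 2)
      (Ioo 0 1) := fun x hx ↦ by
    have hx' := one_add_pos (Ioo_subset_Ico_self hx)
    simp only [weight, Real.sq_sqrt hx'.le, div_mul_cancel₀ _ hx'.ne']
  have weight_ne_zero : ∀ x ∈ Ioo 0 1, weight x ≠ 0 := fun x hx ↦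
    (div_pos (mul_pos hx.1 (sub_pos.2 (pow_lt_one₀ hx.1.le hx.2 two_ne_zero)))
      (one_add_pos (Ioo_subset_Ico_self hx))).ne'
  exact ⟨_, (hU.congr weight_mul_sq fun _ _ ↦ rfl).mul_left weight_ne_zero (by simp [weight])
    (fun x hx ↦ (Real.sqrt_pos.2 (one_add_pos hx)).ne')
    (fun x hx ↦ hasDerivAt_sqrt_one_add_three_mul (one_add_pos hx))
    (fun x hx ↦ (hasDerivAt_weight_mul_deriv_sqrt
      (one_add_pos hx)).continuousAt.continuousWithinAt)
    fun x hx ↦ hasDerivAt_weight_mul_deriv_sqrt (one_add_pos (Ioo_subset_Ico_self hx))⟩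

end QuadraticTransformation

open QuadraticTransformation in
theorem mainTheorem1 (x : ℝ) (hx0 : 0 < x) (hx1 : x < 1) :
    Real.sqrt (1 + 3 * x) * ₂F₁ (1 / 4 : ℝ) (3 / 4 : ℝ) (1 : ℝ) (x ^ 2) =
      ₂F₁ (1 / 4 : ℝ) (3 / 4 : ℝ) (1 : ℝ) (1 - ((1 - x) / (1 + 3 * x)) ^ 2) := by
  obtain ⟨U, hU⟩ := isRegularSolution_sqrt_mul_comp_sq
  obtain ⟨V, hV⟩ := isRegularSolution_comp_complementaryArg
  have lhs_ne_zero : ∀ y ∈ Ico 0 1,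
      √(1 + 3 * y) * ₂F₁ (1 / 4 : ℝ) (3 / 4 : ℝ) (1 : ℝ) (y ^ 2) ≠ 0 := fun y hy ↦
    have sqrt_pos := Real.sqrt_pos.2 (by linarith [hy.1] : 0 < 1 + 3 * y)
    have F_pos := ordinaryHypergeometric_pos (by norm_num) (by norm_num) one_pos
      ⟨sq_nonneg y, pow_lt_one₀ hy.1 hy.2 two_ne_zero⟩
    (mul_pos sqrt_pos F_pos).ne'
  exact hU.eqOn_of_eq_left hV lhs_ne_zero (by simp [complementaryArg_zero]) ⟨hx0.le, hx1⟩
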